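/- Let $\epsilon,\sigma\in\mathbb{R}$ and put $$a=\tfrac{5\sigma}{4}-\tfrac{\epsilon}{4}+\tfrac34,\quad b=\tfrac{\epsilon}{16}-\tfrac{15\sigma}{16}-\tfrac1{16},\quad c=\tfrac{\epsilon}{8}+\tfrac{3\sigma}{8}-\tfrac38,\quad d=\tfrac1{16}-\tfrac{\sigma}{16}-\tfrac{\epsilon}{16},$$ $$a_1=\tfrac{5\sigma}{4}-\tfrac{3\epsilon}{16}+\tfrac{11}{16},\quad a_0=\tfrac{13\sigma}{8}-\tfrac{5\epsilon}{16}+\tfrac{13}{16},\quad b_0=\tfrac5{16}-\tfrac{9\sigma}{8}-\tfrac{\epsilon}{16},\quad c_0=\tfrac{3\epsilon}{16}+\tfrac{7\sigma}{16}-\tfrac7{16}.$$ For $N\ge 4$ and $h>0$ let $T_{\epsilon,\sigma}$ (the stiffness matrix of the one-dimensional cell-centered Galerkin method on a uniform mesh of $N$ cells of width $h$) be the symmetric $N\times N$ matrix equal to $\frac1h$ times the matrix with main diagonal $(a_0,a_1,a,\dots,a,a_1,a_0)$, first super- and subdiagonals $(b_0,b,\dots,b,b_0)$, second super- and subdiagonals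 $(c_0,c,\dots,c,c_0)$, third super- and subdiagonals $(d,\dots,d)$, and all other entries $0$. Let $T_M$ be the symmetric $N\times N$ Toeplitz matrix whose main diagonal entries are $A=\max\{a_0,a_1,a\}$, whose first, second and third super- and subdiagonal entries are $B=\max\{b_0,b\}$, $C=\max\{c_0,c\}$ and $d$ respectively, and whose other entries are $0$. Call a real square matrix monotone if it is nonsingular and its inverse is entrywise nonnegative, and call it an $M$-matrix if it has the form $sI-P$ with $s>0$, $P$ entrywise nonnegative, and $s\ge\rho(P)$, the spectral radius of $P$. If $\sigma+\epsilon=1$ and $1<\sigma\le \frac{104\sqrt2}{79}-\frac{12}{79}$, then $T_M$ and $T_{\epsilon,\sigma}$ are monotone, and $T_{\epsilon,\sigma}$ is not an $M$-matrix. -/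

import Mathlib

namespace CCG

/-- Coefficients of the one-dimensional cell-centred Galerkin stiffness matrix. -/
noncomputable def coeffA (ε σ : ℝ) : ℝ := 5 * σ / 4 - ε / 4 + 3 / 4

noncomputable def coeffB (ε σ : ℝ) : ℝ := ε / 16 - 15 * σ / 16 - 1 / 16

noncomputable def coeffC (ε σ : ℝ) : ℝ := ε / 8 + 3 * σ / 8 - 3 / 8

noncomputable def coeffD (ε σ : ℝ) : ℝ := 1 / 16 - σ / 16 - ε / 16

noncomputable def coeffA1 (ε σ : ℝ) : ℝ := 5 * σ / 4 - 3 * ε / 16 + 11 / 16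

noncomputable def coeffA0 (ε σ : ℝ) : ℝ := 13 * σ / 8 - 5 * ε / 16 + 13 / 16

noncomputable def coeffB0 (ε σ : ℝ) : ℝ := 5 / 16 - 9 * σ / 8 - ε / 16

noncomputable def coeffC0 (ε σ : ℝ) : ℝ := 3 * ε / 16 + 7 * σ / 16 - 7 / 16

/-- `AtDist k i j`: the position `(i, j)` lies on the `k`-th super- or sub-diagonal. -/
def AtDist {N : ℕ} (k : ℕ) (i j : Fin N) : Prop :=
  i.val + k = j.val ∨ j.val + k = i.val

/-- `i` is the first or the last index. -/
def IsEnd {N : ℕ} (i : Fin N) : Prop := i.val = 0 ∨ i.val + 1 = N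

/-- `i` is the second or the second to last index. -/
def IsNextToEnd {N : ℕ} (i : Fin N) : Prop := i.val = 1 ∨ i.val + 2 = N

open Classical in
/-- The `N × N` seven-diagonal CCG stiffness matrix `T_{ε,σ}` on a uniform mesh of width `h`
(meaningful for `N ≥ 4`). Main diagonal `a₀, a₁, a, …, a, a₁, a₀`; first off-diagonals
`b₀, b, …, b, b₀`; second off-diagonals `c₀, c, …, c, c₀`; third off-diagonals `d`;
everything multiplied by `1 / h`. -/
noncomputable def stiffness (N : ℕ) (h ε σ : ℝ) : Matrix (Fin N) (Fin N) ℝ :=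
  (1 / h) • Matrix.of fun i j =>
    if i = j then
      if IsEnd i then coeffA0 ε σ
      else if IsNextToEnd i then coeffA1 ε σ
      else coeffA ε σ
    else if AtDist 1 i j then
      if IsEnd i ∨ IsEnd j then coeffB0 ε σ else coeffB ε σ
    else if AtDist 2 i j then
      if IsEnd i ∨ IsEnd j then coeffC0 ε σ else coeffC ε σ
    else if AtDist 3 i j then coeffD ε σ
    else 0

open Classical in
/-- The symmetric `N × N` Toeplitz comparison matrix `T_M`, with bands
`A = max {a₀, a₁, a}`, `B = max {b₀, b}`, `C = max {c₀, c}` and `d`. -/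
noncomputable def toeplitzMax (N : ℕ) (ε σ : ℝ) : Matrix (Fin N) (Fin N) ℝ :=
  Matrix.of fun i j =>
    if i = j then max (coeffA0 ε σ) (max (coeffA1 ε σ) (coeffA ε σ))
    else if AtDist 1 i j then max (coeffB0 ε σ) (coeffB ε σ)
    else if AtDist 2 i j then max (coeffC0 ε σ) (coeffC ε σ)
    else if AtDist 3 i j then coeffD ε σ
    else 0

/-- A real square matrix is monotone (inverse-nonnegative) if it is nonsingular and its inverse
is entrywise nonnegative. -/
def IsMonotone {N : ℕ} (T : Matrix (Fin N) (Fin N) ℝ) : Prop :=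
  IsUnit T.det ∧ ∀ i j, 0 ≤ T⁻¹ i j

/-- A (possibly singular) `M`-matrix: `T = s I - P` with `s > 0`, `P` entrywise nonnegative and
`s` at least the spectral radius of `P`. -/
def IsMMatrix {N : ℕ} (T : Matrix (Fin N) (Fin N) ℝ) : Prop :=
  ∃ (s : ℝ) (P : Matrix (Fin N) (Fin N) ℝ), 0 < s ∧ (∀ i j, 0 ≤ P i j) ∧
    spectralRadius ℂ (P.map (algebraMap ℝ ℂ)) ≤ ENNReal.ofReal s ∧
    T = s • (1 : Matrix (Fin N) (Fin N) ℝ) - P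

end CCG

/-! On σ + ε = 1 the coefficient d vanishes, so T_M is pentadiagonal Toeplitz with band signs +, -,
+. After a checkerboard sign change its symbol is, up to a power of z, C(1 + w₁z + z²)(1 + w₂z + z²)
with w₁, w₂ ≥ 2; for σ > 1 the upper bound on σ says exactly that w₁, w₂ are real. Each quadratic
splits into factors 1 + ρz with ρ ≥ 0, which preserve total nonnegativity
(`IsTotallyNonneg.addPrevRow`). Inverse entries are signed minors over the determinant, and the
checkerboard cancels the signs (`isMonotone_of_checkerboard`).

Up to the factor 1/h, T_{ε,σ} is entrywise at most T_M and sends an explicit positive vector to a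
positive one, so the comparison principle `IsMonotone.of_le` transfers monotonicity. It is not an
M-matrix because its off-diagonal entry c₀/h is positive. -/

namespace CCG

/-! ### Total nonnegativity of banded Toeplitz matrices -/

/-- A matrix indexed by the integers is totally nonnegative if all its minors are nonnegative. -/
def IsTotallyNonneg (M : ℤ → ℤ → ℝ) : Prop :=
  ∀ (n : ℕ) (r c : Fin n → ℤ), StrictMono r → StrictMono c →
    0 ≤ (Matrix.of fun i j => M (r i) (c j)).det

/-- The identity matrix indexed by the integers. -/
def intIdentity (i j : ℤ) : ℝ := if i = j then 1 else 0

/-- Add `ρ` times the preceding row to every row. -/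
def addPrevRow (ρ : ℝ) (M : ℤ → ℤ → ℝ) (i j : ℤ) : ℝ := M i j + ρ * M (i - 1) j

lemma isTotallyNonneg_intIdentity : IsTotallyNonneg intIdentity := by
  intro n r c hr hc
  by_cases h : Set.range r = Set.range c
  · have hrc : r = c := (hr.range_inj hc).1 h
    have : (Matrix.of fun i j => intIdentity (r i) (c j)) = (1 : Matrix (Fin n) (Fin n) ℝ) := by
      ext i j
      simp [intIdentity, hrc, Matrix.one_apply, hc.injective.eq_iff]
    simp [this]
  · have hex : ∃ i, ∀ j, r i ≠ c j := by
      by_contra! hcon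
      have hsub : Finset.univ.image r ⊆ Finset.univ.image c := by
        intro x hx
        obtain ⟨i, -, rfl⟩ := Finset.mem_image.1 hx
        obtain ⟨j, hj⟩ := hcon i
        exact Finset.mem_image.2 ⟨j, Finset.mem_univ _, hj.symm⟩
      have heq := Finset.eq_of_subset_of_card_le hsub (by
        rw [Finset.card_image_of_injective _ hr.injective,
          Finset.card_image_of_injective _ hc.injective])
      apply h
      have := congrArg (fun s : Finset ℤ => (s : Set ℤ)) heq
      simpa using this
    obtain ⟨i, hi⟩ := hex
    rw [Matrix.det_eq_zero_of_row_eq_zero i]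
    intro j
    simp [intIdentity, hi j]

/-- Multilinearity in the rows expands a minor into powers of ρ times minors of `M` with some row
indices lowered by one. Lowered indices stay weakly increasing, so each term is a genuine minor or
has a repeated row. -/
lemma IsTotallyNonneg.addPrevRow {M : ℤ → ℤ → ℝ} (hM : IsTotallyNonneg M) {ρ : ℝ} (hρ : 0 ≤ ρ) :
    IsTotallyNonneg (addPrevRow ρ M) := by
  intro n r c hr hc
  let f := (Matrix.detRowAlternating (n := Fin n) (R := ℝ)).toMultilinearMap
  let u : Fin n → Fin n → ℝ := fun i j => M (r i) (c j)
  let v : Fin n → Fin n → ℝ := fun i j => M (r i - 1) (c j)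
  have hdet : (Matrix.of fun i j => CCG.addPrevRow ρ M (r i) (c j)).det
      = f ((fun i => ρ • v i) + u) := by
    change Matrix.det _ = Matrix.det _
    congr 1
    ext i j
    simp [CCG.addPrevRow, u, v, add_comm]
  rw [hdet, MultilinearMap.map_add_univ]
  refine Finset.sum_nonneg fun s _ => ?_
  let r' : Fin n → ℤ := fun i => if i ∈ s then r i - 1 else r i
  have hrow : s.piecewise (fun i => ρ • v i) u
      = s.piecewise (fun i => (fun _ : Fin n => ρ) i • s.piecewise v u i) (s.piecewise v u) := by
    ext i j
    by_cases hi : i ∈ s <;> simp [hi]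
  rw [hrow, MultilinearMap.map_piecewise_smul]
  refine smul_nonneg (Finset.prod_nonneg fun _ _ => hρ) ?_
  have hmat : f (s.piecewise v u) = (Matrix.of fun i j => M (r' i) (c j)).det := by
    change Matrix.det _ = Matrix.det _
    congr 1
    ext i j
    by_cases hi : i ∈ s <;> simp [hi, u, v, r']
  rw [hmat]
  have hmono : Monotone r' := by
    intro i j hij
    rcases hij.eq_or_lt with rfl | hlt
    · exact le_rfl
    · have := hr hlt
      simp only [r']
      split_ifs <;> omega
  by_cases hinj : Function.Injective r'
  · exact hM n r' c (hmono.strictMono_of_injective hinj) hc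
  · simp only [Function.Injective, not_forall] at hinj
    obtain ⟨i, j, hij, hne⟩ := hinj
    rw [Matrix.det_zero_of_row_eq hne]
    ext k
    simp [hij]

/-- The step with symbol `1 + w z + z²` preserves total nonnegativity when its roots are real. -/
lemma IsTotallyNonneg.quadratic {M : ℤ → ℤ → ℝ} (hM : IsTotallyNonneg M) {w : ℝ} (hw : 2 ≤ w) :
    IsTotallyNonneg fun i j => M i j + w * M (i - 1) j + M (i - 2) j := by
  have hD : 0 ≤ w ^ 2 - 4 := by nlinarith
  set s := Real.sqrt (w ^ 2 - 4) with hs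
  have hs2 : s ^ 2 = w ^ 2 - 4 := Real.sq_sqrt hD
  have hs0 : 0 ≤ s := Real.sqrt_nonneg _
  have hsw : s ≤ w := by nlinarith
  -- The two values of ρ have sum w and product 1.
  have key := (hM.addPrevRow (ρ := (w + s) / 2) (by linarith)).addPrevRow
    (ρ := (w - s) / 2) (by linarith)
  convert key using 3 with i j
  simp only [CCG.addPrevRow, show i - 1 - 1 = i - 2 by ring]
  linear_combination (M (i - 2) j / 4) * hs2

/-- Pentadiagonal Toeplitz matrix, indexed by the integers, with bands `A`, `B`, `C`. -/
def pentadiagonal (A B C : ℝ) (i j : ℤ) : ℝ :=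
  if i = j then A
  else if i + 1 = j ∨ j + 1 = i then B
  else if i + 2 = j ∨ j + 2 = i then C
  else 0

/-- Matching coefficients of the factored symbol gives C(w₁ + w₂) = B and C(2 + w₁w₂) = A; `hdisc`
makes the wᵢ real. -/
lemma isTotallyNonneg_pentadiagonal {A B C : ℝ} (hC : 0 < C) (hdisc : 4 * C * (A - 2 * C) ≤ B ^ 2)
    (hBC : 4 * C ≤ B) (hAB : 2 * B ≤ A + 2 * C) :
    IsTotallyNonneg (pentadiagonal A B C) := by
  set s := Real.sqrt (B ^ 2 - 4 * C * (A - 2 * C)) with hs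
  have hs2 : s ^ 2 = B ^ 2 - 4 * C * (A - 2 * C) := Real.sq_sqrt (by linarith)
  have hs0 : 0 ≤ s := Real.sqrt_nonneg _
  -- This is w₁ ≥ 2; squared, it reduces to `hAB`.
  have hsB : s ≤ B - 4 * C := by
    refine abs_le_of_sq_le_sq' ?_ (by linarith) |>.2
    nlinarith
  set w₁ := (B - s) / (2 * C) with hw₁
  set w₂ := (B + s) / (2 * C) with hw₂
  have h₁ : 2 ≤ w₁ := by rw [hw₁, le_div_iff₀ (by positivity)]; linarith
  have h₂ : 2 ≤ w₂ := by rw [hw₂, le_div_iff₀ (by positivity)]; linarith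
  have hsum : C * (w₁ + w₂) = B := by rw [hw₁, hw₂]; field_simp; ring
  have hprod : C * (2 + w₁ * w₂) = A := by
    rw [hw₁, hw₂]; field_simp; linear_combination -hs2
  have key := (isTotallyNonneg_intIdentity.quadratic h₁).quadratic h₂
  intro n r c hr hc
  -- The product of the two steps has its bands on one side of the diagonal; shifting rows by two
  -- centres them.
  have hminor := key n (fun i => r i + 2) c (fun i j hij => by simpa using hr hij) hc
  have hmat : (Matrix.of fun i j => pentadiagonal A B C (r i) (c j)) =
      C • Matrix.of fun i j =>
        (fun i j => (intIdentity i j + w₁ * intIdentity (i - 1) j + intIdentity (i - 2) j)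
          + w₂ * (intIdentity (i - 1) j + w₁ * intIdentity (i - 1 - 1) j
            + intIdentity (i - 1 - 2) j)
          + (intIdentity (i - 2) j + w₁ * intIdentity (i - 2 - 1) j
            + intIdentity (i - 2 - 2) j)) (r i + 2) (c j) := by
    ext i j
    simp only [Matrix.of_apply, Matrix.smul_apply, smul_eq_mul]
    generalize r i = p
    generalize c j = q
    by_cases hk : -2 ≤ q - p ∧ q - p ≤ 2
    · obtain ⟨k, rfl⟩ : ∃ k, q = p + k := ⟨q - p, by ring⟩
      obtain ⟨h1, h2⟩ := hk
      rw [add_sub_cancel_left] at h1 h2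
      rw [← hsum, ← hprod]
      interval_cases k <;> norm_num [pentadiagonal, intIdentity, sub_eq_add_neg, add_assoc] <;>
        exact Or.inl (by ring)
    · have h0 : pentadiagonal A B C p q = 0 := by
        simp only [pentadiagonal]
        rw [if_neg (by omega), if_neg (by omega), if_neg (by omega)]
      have e1 : intIdentity (p + 2) q = 0 := if_neg (by omega)
      have e2 : intIdentity (p + 2 - 1) q = 0 := if_neg (by omega)
      have e3 : intIdentity (p + 2 - 2) q = 0 := if_neg (by omega)
      have e4 : intIdentity (p + 2 - 1 - 1) q = 0 := if_neg (by omega)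
      have e5 : intIdentity (p + 2 - 1 - 2) q = 0 := if_neg (by omega)
      have e6 : intIdentity (p + 2 - 2 - 1) q = 0 := if_neg (by omega)
      have e7 : intIdentity (p + 2 - 2 - 2) q = 0 := if_neg (by omega)
      rw [h0, e1, e2, e3, e4, e5, e6, e7]
      ring
  rw [hmat, Matrix.det_smul]
  exact mul_nonneg (by positivity) hminor

/-! ### Monotone matrices and the comparison principle -/

/-- A nonsingular matrix which becomes totally nonnegative after a checkerboard change of signs
is monotone. -/
lemma isMonotone_of_checkerboard {N : ℕ} {T : Matrix (Fin N) (Fin N) ℝ} {M : ℤ → ℤ → ℝ}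
    (hM : IsTotallyNonneg M) (hT : ∀ i j : Fin N, T i j = (-1) ^ (i.val + j.val) * M i j)
    (hdet : T.det ≠ 0) : IsMonotone T := by
  refine ⟨isUnit_iff_ne_zero.2 hdet, ?_⟩
  cases N with
  | zero => exact fun i => i.elim0
  | succ n =>
    let Q : Matrix (Fin (n + 1)) (Fin (n + 1)) ℝ := Matrix.of fun i j => M i j
    let D : Matrix (Fin (n + 1)) (Fin (n + 1)) ℝ := Matrix.diagonal fun i => (-1) ^ i.val
    have hcast : StrictMono fun i : Fin (n + 1) => ((i.val : ℕ) : ℤ) := by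
      intro i j hij
      simpa using hij
    have hTQ : T = D * Q * D := by
      ext i j
      rw [Matrix.mul_diagonal, Matrix.diagonal_mul, hT, pow_add]
      simp only [Q, Matrix.of_apply]
      ring
    have hDD : D * D = 1 := by
      rw [Matrix.diagonal_mul_diagonal, ← Matrix.diagonal_one]
      congr 1
      ext i
      rw [← pow_add, ← two_mul, pow_mul]
      simp
    have hDinv : D⁻¹ = D := Matrix.inv_eq_left_inv hDD
    have hQ0 : 0 ≤ Q.det := hM _ _ _ hcast hcast
    intro i j
    rw [hTQ, Matrix.mul_inv_rev, Matrix.mul_inv_rev, hDinv, ← mul_assoc, Matrix.mul_diagonal,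
      Matrix.diagonal_mul, Matrix.inv_def, Matrix.smul_apply,
      Matrix.adjugate_fin_succ_eq_det_submatrix, Ring.inverse_eq_inv', smul_eq_mul]
    have hminor : 0 ≤ (Q.submatrix j.succAbove i.succAbove).det :=
      hM n (fun k => ((j.succAbove k).val : ℤ)) (fun k => ((i.succAbove k).val : ℤ))
        (hcast.comp (Fin.strictMono_succAbove j)) (hcast.comp (Fin.strictMono_succAbove i))
    have hsign : ((-1 : ℝ) ^ i.val * (-1) ^ j.val) * (-1) ^ (j.val + i.val) = 1 := by
      rw [← pow_add, ← pow_add, add_comm j.val, ← two_mul, pow_mul]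
      simp
    calc 0 ≤ Q.det⁻¹ * (Q.submatrix j.succAbove i.succAbove).det :=
          mul_nonneg (inv_nonneg.2 hQ0) hminor
      _ = _ := by
          linear_combination -(Q.det⁻¹ * (Q.submatrix j.succAbove i.succAbove).det) * hsign

lemma isMonotone_of_mulVec_nonneg {N : ℕ} {T : Matrix (Fin N) (Fin N) ℝ}
    (hT : ∀ u : Fin N → ℝ, (∀ i, 0 ≤ T.mulVec u i) → ∀ i, 0 ≤ u i) : IsMonotone T := by
  have hdet : T.det ≠ 0 := by
    intro h0
    obtain ⟨v, hv, hTv⟩ := Matrix.exists_mulVec_eq_zero_iff.2 h0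
    apply hv
    ext i
    have h₁ := hT v (by simp [hTv]) i
    have h₂ := hT (-v) (by simp [Matrix.mulVec_neg, hTv]) i
    simp only [Pi.neg_apply, Pi.zero_apply] at *
    linarith
  have hunit : IsUnit T.det := isUnit_iff_ne_zero.2 hdet
  refine ⟨hunit, fun i j => ?_⟩
  refine hT (fun k => T⁻¹ k j) (fun k => ?_) i
  have : T.mulVec (fun k => T⁻¹ k j) k = (T * T⁻¹) k j := rfl
  rw [this, Matrix.mul_nonsing_inv _ hunit, Matrix.one_apply]
  split_ifs <;> norm_num

lemma IsMonotone.nonneg_of_mulVec {N : ℕ} {T : Matrix (Fin N) (Fin N) ℝ} (hT : IsMonotone T)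
    {u : Fin N → ℝ} (hu : ∀ i, 0 ≤ T.mulVec u i) (i : Fin N) : 0 ≤ u i := by
  have h : u = T⁻¹.mulVec (T.mulVec u) := by
    rw [Matrix.mulVec_mulVec, Matrix.nonsing_inv_mul _ hT.1, Matrix.one_mulVec]
  rw [h]
  change 0 ≤ ∑ j, T⁻¹ i j * T.mulVec u j
  exact Finset.sum_nonneg fun j _ => mul_nonneg (hT.2 i j) (hu j)

/-- Strictness holds because an invertible matrix has no zero row in its inverse. -/
lemma IsMonotone.pos_of_mulVec {N : ℕ} {T : Matrix (Fin N) (Fin N) ℝ} (hT : IsMonotone T)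
    {u : Fin N → ℝ} (hu : ∀ i, 0 < T.mulVec u i) (i : Fin N) : 0 < u i := by
  have h : u = T⁻¹.mulVec (T.mulVec u) := by
    rw [Matrix.mulVec_mulVec, Matrix.nonsing_inv_mul _ hT.1, Matrix.one_mulVec]
  rw [h]
  have hne : ∃ j, T⁻¹ i j ≠ 0 := by
    by_contra! h0
    have h1 : (T⁻¹ * T) i i = 1 := by rw [Matrix.nonsing_inv_mul _ hT.1, Matrix.one_apply_eq]
    simp [Matrix.mul_apply, h0] at h1
  obtain ⟨j, hj⟩ := hne
  exact Finset.sum_pos' (fun k _ => mul_nonneg (hT.2 i k) (hu k).le)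
    ⟨j, Finset.mem_univ _, mul_pos ((hT.2 i j).lt_of_ne' hj) (hu j)⟩

lemma IsMonotone.smul {N : ℕ} {T : Matrix (Fin N) (Fin N) ℝ} (hT : IsMonotone T) {k : ℝ}
    (hk : 0 < k) : IsMonotone (k • T) := by
  refine isMonotone_of_mulVec_nonneg fun u hu => hT.nonneg_of_mulVec fun i => ?_
  have := hu i
  rw [Matrix.smul_mulVec, Pi.smul_apply, smul_eq_mul] at this
  exact nonneg_of_mul_nonneg_right this hk

/-- Comparison principle: a matrix dominated by a monotone matrix and mapping a positive vector to
a positive vector is monotone. -/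
lemma IsMonotone.of_le {N : ℕ} {M T : Matrix (Fin N) (Fin N) ℝ} (hM : IsMonotone M)
    (hle : ∀ i j, T i j ≤ M i j) {e : Fin N → ℝ} (he : ∀ i, 0 < e i)
    (hTe : ∀ i, 0 < T.mulVec e i) : IsMonotone T := by
  refine isMonotone_of_mulVec_nonneg fun u hu => ?_
  by_contra! hneg
  obtain ⟨i₀, hi₀⟩ := hneg
  obtain ⟨k, -, hk⟩ := Finset.exists_min_image Finset.univ (fun i => u i / e i)
    ⟨i₀, Finset.mem_univ _⟩
  -- The least t with u + t e ≥ 0; contact with zero occurs at k.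
  set t := -(u k / e k) with ht
  have ht0 : 0 < t := by
    have := hk i₀ (Finset.mem_univ _)
    have := div_neg_of_neg_of_pos hi₀ (he i₀)
    linarith
  set v : Fin N → ℝ := u + t • e with hv
  have hv0 : ∀ i, 0 ≤ v i := by
    intro i
    have h1 := hk i (Finset.mem_univ _)
    have h2 : u i / e i * e i = u i := div_mul_cancel₀ _ (he i).ne'
    have h3 := mul_le_mul_of_nonneg_right h1 (he i).le
    simp only [hv, ht, Pi.add_apply, Pi.smul_apply, smul_eq_mul]
    linarith
  have hvk : v k = 0 := by
    have h2 : u k / e k * e k = u k := div_mul_cancel₀ _ (he k).ne'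
    simp only [hv, ht, Pi.add_apply, Pi.smul_apply, smul_eq_mul]
    linarith
  have hMv : ∀ i, 0 < M.mulVec v i := by
    intro i
    have h1 : 0 < T.mulVec v i := by
      rw [hv, Matrix.mulVec_add, Matrix.mulVec_smul, Pi.add_apply, Pi.smul_apply, smul_eq_mul]
      have := mul_pos ht0 (hTe i)
      have := hu i
      linarith
    change 0 < ∑ j, T i j * v j at h1
    exact h1.trans_le (Finset.sum_le_sum fun j _ => mul_le_mul_of_nonneg_right (hle i j) (hv0 j))
  exact (hM.pos_of_mulVec hMv k).ne' hvk

/-- The off-diagonal entries of an `M`-matrix are nonpositive. -/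
lemma IsMMatrix.apply_nonpos {N : ℕ} {T : Matrix (Fin N) (Fin N) ℝ} (hT : IsMMatrix T)
    {i j : Fin N} (hij : i ≠ j) : T i j ≤ 0 := by
  obtain ⟨s, P, -, hP, -, rfl⟩ := hT
  simpa [hij] using hP i j

/-! ### Monotone pentadiagonal Toeplitz matrices -/

lemma sum_ite_le_of_subsingleton {ι : Type*} (s : Finset ι) (p : ι → Prop) [DecidablePred p]
    (hp : ∀ i j, p i → p j → i = j) {β : ℝ} (hβ : 0 ≤ β) :
    ∑ i ∈ s, (if p i then β else 0) ≤ β := by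
  rw [← Finset.sum_filter, Finset.sum_const, nsmul_eq_mul]
  have hcard : (s.filter p).card ≤ 1 := Finset.card_le_one.2 fun a ha b hb =>
    hp a b (Finset.mem_filter.1 ha).2 (Finset.mem_filter.1 hb).2
  have : ((s.filter p).card : ℝ) ≤ 1 := by exact_mod_cast hcard
  nlinarith

/-- A diagonally dominant pentadiagonal Toeplitz matrix is nonsingular. -/
lemma det_pentadiagonal_ne_zero {N : ℕ} {A B C : ℝ} (h : 2 * |B| + 2 * |C| < A) :
    (Matrix.of fun i j : Fin N => pentadiagonal A B C i j).det ≠ 0 := by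
  refine det_ne_zero_of_sum_row_lt_diag fun k => ?_
  have hA : 0 < A := by linarith [abs_nonneg B, abs_nonneg C]
  have hentry : ∀ j ∈ Finset.univ.erase k,
      ‖(Matrix.of fun i j : Fin N => pentadiagonal A B C i j) k j‖ ≤
        ((if k.val + 1 = j.val then |B| else 0) + (if j.val + 1 = k.val then |B| else 0)) +
        ((if k.val + 2 = j.val then |C| else 0) + (if j.val + 2 = k.val then |C| else 0)) := by
    intro j hj
    have hkj : k.val ≠ j.val := fun hval => (Finset.mem_erase.1 hj).1 (Fin.ext hval.symm)
    have := abs_nonneg B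
    have := abs_nonneg C
    simp only [Matrix.of_apply, pentadiagonal, Real.norm_eq_abs]
    split_ifs <;> first | omega | simp
  have hdiag : ‖(Matrix.of fun i j : Fin N => pentadiagonal A B C i j) k k‖ = A := by
    simp [pentadiagonal, abs_of_pos hA]
  rw [hdiag]
  refine (Finset.sum_le_sum hentry).trans_lt ?_
  rw [Finset.sum_add_distrib, Finset.sum_add_distrib, Finset.sum_add_distrib]
  have h1 := sum_ite_le_of_subsingleton (Finset.univ.erase k) (fun j => k.val + 1 = j.val)
    (fun i j hi hj => Fin.ext (by omega)) (abs_nonneg B)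
  have h2 := sum_ite_le_of_subsingleton (Finset.univ.erase k) (fun j => j.val + 1 = k.val)
    (fun i j hi hj => Fin.ext (by omega)) (abs_nonneg B)
  have h3 := sum_ite_le_of_subsingleton (Finset.univ.erase k) (fun j => k.val + 2 = j.val)
    (fun i j hi hj => Fin.ext (by omega)) (abs_nonneg C)
  have h4 := sum_ite_le_of_subsingleton (Finset.univ.erase k) (fun j => j.val + 2 = k.val)
    (fun i j hi hj => Fin.ext (by omega)) (abs_nonneg C)
  linarith

/-- Pentadiagonal Toeplitz matrices with alternating band signs whose symbol has only real roots
are monotone. -/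
lemma isMonotone_pentadiagonal {N : ℕ} {A B C : ℝ} (hC : 0 < C)
    (hdisc : 4 * C * (A - 2 * C) ≤ B ^ 2) (hBC : 4 * C ≤ -B) (hdom : 2 * |B| + 2 * |C| < A) :
    IsMonotone (Matrix.of fun i j : Fin N => pentadiagonal A B C i j) := by
  have hB : |B| = -B := abs_of_neg (by linarith)
  have hC' : |C| = C := abs_of_pos hC
  -- Dominance serves twice: for nonsingularity and for the condition `hAB`.
  refine isMonotone_of_checkerboard
    (isTotallyNonneg_pentadiagonal (A := A) (B := -B) hC (by rwa [neg_sq]) hBC (by linarith))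
    (fun i j => ?_) (det_pentadiagonal_ne_zero hdom)
  have hpar : ∀ m k : ℕ, (-1 : ℝ) ^ (2 * m + k) = (-1) ^ k := by
    intro m k
    rw [pow_add, pow_mul]
    simp
  simp only [Matrix.of_apply, pentadiagonal]
  split_ifs with h1 h2 h3
  · rw [show i.val + j.val = 2 * i.val + 0 by omega, hpar]; simp
  · rcases h2 with h2 | h2
    · rw [show i.val + j.val = 2 * i.val + 1 by omega, hpar]; simp
    · rw [show i.val + j.val = 2 * j.val + 1 by omega, hpar]; simp
  · rcases h3 with h3 | h3
    · rw [show i.val + j.val = 2 * (i.val + 1) + 0 by omega, hpar]; simp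
    · rw [show i.val + j.val = 2 * (j.val + 1) + 0 by omega, hpar]; simp
  · simp

/-! ### The matrices on the line σ + ε = 1 -/

/-- The entries of `h • T_{ε,σ}` on the line `σ + ε = 1`. -/
noncomputable def stiffnessEntry (N : ℕ) (σ : ℝ) (i j : ℕ) : ℝ :=
  if i = j then
    if i = 0 ∨ i + 1 = N then 31 * σ / 16 + 1 / 2
    else if i = 1 ∨ i + 2 = N then 23 * σ / 16 + 1 / 2
    else 3 * σ / 2 + 1 / 2
  else if i + 1 = j ∨ j + 1 = i then
    if (i = 0 ∨ i + 1 = N) ∨ j = 0 ∨ j + 1 = N then 1 / 4 - 17 * σ / 16 else -σ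
  else if i + 2 = j ∨ j + 2 = i then (σ - 1) / 4
  else 0

lemma stiffness_eq (N : ℕ) (h : ℝ) {ε σ : ℝ} (hsum : σ + ε = 1) :
    stiffness N h ε σ = (1 / h) • Matrix.of fun i j : Fin N => stiffnessEntry N σ i j := by
  obtain rfl : ε = 1 - σ := by linarith
  unfold stiffness
  congr 2
  ext i j
  have hij : i = j ↔ i.val = j.val := Fin.ext_iff
  split_ifs <;> simp only [AtDist, IsEnd, IsNextToEnd, hij] at * <;>
    simp only [stiffnessEntry, coeffA, coeffB, coeffC, coeffD, coeffA0, coeffA1, coeffB0,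
      coeffC0] <;>
    split_ifs <;> ring1

lemma toeplitzMax_eq (N : ℕ) {ε σ : ℝ} (hsum : σ + ε = 1) (hσ : 0 ≤ σ) (hσ' : σ ≤ 4) :
    toeplitzMax N ε σ = Matrix.of fun i j : Fin N =>
      pentadiagonal (31 * σ / 16 + 1 / 2) (1 / 4 - 17 * σ / 16) ((σ - 1) / 4) i j := by
  obtain rfl : ε = 1 - σ := by linarith
  have hA : max (coeffA0 (1 - σ) σ) (max (coeffA1 (1 - σ) σ) (coeffA (1 - σ) σ))
      = 31 * σ / 16 + 1 / 2 := by
    rw [max_eq_left]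
    · simp only [coeffA0]; ring
    · apply max_le <;> simp only [coeffA0, coeffA1, coeffA] <;> linarith
  have hB : max (coeffB0 (1 - σ) σ) (coeffB (1 - σ) σ) = 1 / 4 - 17 * σ / 16 := by
    rw [max_eq_left]
    · simp only [coeffB0]; ring
    · simp only [coeffB0, coeffB]; linarith
  have hC : max (coeffC0 (1 - σ) σ) (coeffC (1 - σ) σ) = (σ - 1) / 4 := by
    rw [max_eq_left]
    · simp only [coeffC0]; ring
    · simp only [coeffC0, coeffC]; linarith
  have hD : coeffD (1 - σ) σ = 0 := by simp only [coeffD]; ring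
  ext i j
  simp only [toeplitzMax, hA, hB, hC, hD, Matrix.of_apply, pentadiagonal, AtDist, Fin.ext_iff,
    ite_self]
  norm_cast

lemma stiffnessEntry_le_pentadiagonal {N : ℕ} {σ : ℝ} (hσ : 0 ≤ σ) (hσ' : σ ≤ 4) (i j : ℕ) :
    stiffnessEntry N σ i j ≤
      pentadiagonal (31 * σ / 16 + 1 / 2) (1 / 4 - 17 * σ / 16) ((σ - 1) / 4) i j := by
  simp only [stiffnessEntry, pentadiagonal]
  norm_cast
  split_ifs <;> linarith

/-! ### The positive test vector -/

lemma sum_range_eq_sum_window {N k m : ℕ} (hkm : k + m ≤ N) {g : ℕ → ℝ}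
    (hg : ∀ j < N, j < k ∨ k + m ≤ j → g j = 0) :
    ∑ j ∈ Finset.range N, g j = ∑ t ∈ Finset.range m, g (k + t) := by
  have hsub : Finset.Ico k (k + m) ⊆ Finset.range N := by
    intro j hj
    simp only [Finset.mem_Ico, Finset.mem_range] at *
    omega
  rw [← Finset.sum_subset hsub fun j hjN hj => hg j (Finset.mem_range.1 hjN) (by
    simp only [Finset.mem_Ico] at hj
    omega), Finset.sum_Ico_eq_sum_range]
  simp

/-- A discretely concave vector mapped to a positive one by the stiffness matrix. -/
noncomputable def concaveVector (N i : ℕ) : ℝ := N / 2 + i * ((N : ℝ) - 1 - i)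

/-- The vector is (i + 1/2)(N - 1/2 - i) + 1/4, a parabola vanishing at the ends of the mesh, plus a
constant. The terms in N cancel in every row: the values are 1 + 5σ/8 in the end rows, 2 + σ/8 next
to them and 2 inside. -/
lemma sum_stiffnessEntry_mul_concaveVector_pos {N : ℕ} (hN : 4 ≤ N) {σ : ℝ} (hσ : 1 < σ)
    {i : ℕ} (hi : i < N) :
    0 < ∑ j ∈ Finset.range N, stiffnessEntry N σ i j * concaveVector N j := by
  have hzero : ∀ j, i + 2 < j ∨ j + 2 < i → stiffnessEntry N σ i j * concaveVector N j = 0 := by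
    intro j hj
    simp only [stiffnessEntry]
    rw [if_neg (by omega), if_neg (by omega), if_neg (by omega), zero_mul]
  obtain ⟨n, rfl⟩ : ∃ n, N = n + 4 := ⟨N - 4, by omega⟩
  have hcases : i = 0 ∨ i = 1 ∨ (∃ k, i = k + 2 ∧ k < n) ∨ i = n + 2 ∨ i = n + 3 := by
    rcases i with _ | _ | k
    · simp
    · simp
    · by_cases hk : k < n
      · exact Or.inr (Or.inr (Or.inl ⟨k, rfl, hk⟩))
      · omega
  rcases hcases with rfl | rfl | ⟨k, rfl, hk⟩ | rfl | rfl
  · rw [sum_range_eq_sum_window (k := 0) (m := 3) (by omega)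
      fun j hjN hj => hzero j (by omega)]
    simp [Finset.sum_range_succ, stiffnessEntry, concaveVector]
    ring_nf
    nlinarith
  · rw [sum_range_eq_sum_window (k := 0) (m := 4) (by omega)
      fun j hjN hj => hzero j (by omega)]
    simp [Finset.sum_range_succ, stiffnessEntry, concaveVector]
    ring_nf
    nlinarith
  · rw [sum_range_eq_sum_window (k := k) (m := 5) (by omega)
      fun j hjN hj => hzero j (by omega)]
    have e0 : stiffnessEntry (n + 4) σ (k + 2) (k + 0) = (σ - 1) / 4 := by
      rw [stiffnessEntry, if_neg (by omega), if_neg (by omega), if_pos (by omega)]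
    have e1 : stiffnessEntry (n + 4) σ (k + 2) (k + 1) = -σ := by
      rw [stiffnessEntry, if_neg (by omega), if_pos (by omega), if_neg (by omega)]
    have e2 : stiffnessEntry (n + 4) σ (k + 2) (k + 2) = 3 * σ / 2 + 1 / 2 := by
      rw [stiffnessEntry, if_pos rfl, if_neg (by omega), if_neg (by omega)]
    have e3 : stiffnessEntry (n + 4) σ (k + 2) (k + 3) = -σ := by
      rw [stiffnessEntry, if_neg (by omega), if_pos (by omega), if_neg (by omega)]
    have e4 : stiffnessEntry (n + 4) σ (k + 2) (k + 4) = (σ - 1) / 4 := by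
      rw [stiffnessEntry, if_neg (by omega), if_neg (by omega), if_pos (by omega)]
    simp only [Finset.sum_range_succ, Finset.sum_range_zero, e0, e1, e2, e3, e4, concaveVector]
    push_cast
    ring_nf
    norm_num
  · rw [sum_range_eq_sum_window (k := n) (m := 4) (by omega)
      fun j hjN hj => hzero j (by omega)]
    have e0 : stiffnessEntry (n + 4) σ (n + 2) (n + 0) = (σ - 1) / 4 := by
      rw [stiffnessEntry, if_neg (by omega), if_neg (by omega), if_pos (by omega)]
    have e1 : stiffnessEntry (n + 4) σ (n + 2) (n + 1) = -σ := by
      rw [stiffnessEntry, if_neg (by omega), if_pos (by omega), if_neg (by omega)]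
    have e2 : stiffnessEntry (n + 4) σ (n + 2) (n + 2) = 23 * σ / 16 + 1 / 2 := by
      rw [stiffnessEntry, if_pos rfl, if_neg (by omega), if_pos (by omega)]
    have e3 : stiffnessEntry (n + 4) σ (n + 2) (n + 3) = 1 / 4 - 17 * σ / 16 := by
      rw [stiffnessEntry, if_neg (by omega), if_pos (by omega), if_pos (by omega)]
    simp only [Finset.sum_range_succ, Finset.sum_range_zero, e0, e1, e2, e3, concaveVector]
    push_cast
    ring_nf
    nlinarith
  · rw [sum_range_eq_sum_window (k := n + 1) (m := 3) (by omega)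
      fun j hjN hj => hzero j (by omega)]
    have e1 : stiffnessEntry (n + 4) σ (n + 3) (n + 1) = (σ - 1) / 4 := by
      rw [stiffnessEntry, if_neg (by omega), if_neg (by omega), if_pos (by omega)]
    have e2 : stiffnessEntry (n + 4) σ (n + 3) (n + 2) = 1 / 4 - 17 * σ / 16 := by
      rw [stiffnessEntry, if_neg (by omega), if_pos (by omega), if_pos (by omega)]
    have e3 : stiffnessEntry (n + 4) σ (n + 3) (n + 3) = 31 * σ / 16 + 1 / 2 := by
      rw [stiffnessEntry, if_pos rfl, if_pos (by omega)]
    simp only [Finset.sum_range_succ, Finset.sum_range_zero, add_assoc, Nat.reduceAdd, e1, e2, e3,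
      concaveVector]
    push_cast
    ring_nf
    nlinarith

end CCG

theorem mainTheorem1 (N : ℕ) (hN : 4 ≤ N) (h : ℝ) (hh : 0 < h) (ε σ : ℝ)
    (hsum : σ + ε = 1) (hσ : 1 < σ)
    (hσ' : σ ≤ 104 * Real.sqrt 2 / 79 - 12 / 79) :
    CCG.IsMonotone (CCG.toeplitzMax N ε σ) ∧
      CCG.IsMonotone (CCG.stiffness N h ε σ) ∧
      ¬ CCG.IsMMatrix (CCG.stiffness N h ε σ) := by
  have hsq : Real.sqrt 2 ^ 2 = 2 := Real.sq_sqrt (by norm_num)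
  -- This is 4C(A - 2C) ≤ B² with denominators cleared; the bound on σ is its positive root.
  have hquad : 79 * σ ^ 2 + 24 * σ ≤ 272 := by
    have : (79 * σ + 12) ^ 2 ≤ (104 * Real.sqrt 2) ^ 2 :=
      pow_le_pow_left₀ (by linarith) (by linarith) 2
    nlinarith
  have hσ2 : σ ≤ 2 := by nlinarith
  have hTM : CCG.IsMonotone (CCG.toeplitzMax N ε σ) := by
    rw [CCG.toeplitzMax_eq N hsum (by linarith) (by linarith)]
    refine CCG.isMonotone_pentadiagonal (by linarith) (by nlinarith) (by linarith) ?_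
    rw [abs_of_neg (by linarith), abs_of_pos (by linarith)]
    linarith
  refine ⟨hTM, ?_, fun hMM => ?_⟩
  · rw [CCG.stiffness_eq N h hsum]
    refine CCG.IsMonotone.smul ?_ (by positivity)
    rw [CCG.toeplitzMax_eq N hsum (by linarith) (by linarith)] at hTM
    refine hTM.of_le (e := fun i => CCG.concaveVector N i)
      (fun i j => CCG.stiffnessEntry_le_pentadiagonal (by linarith) (by linarith) i j)
      (fun i => ?_) fun i => ?_
    · have h1 : (i.val : ℝ) + 1 ≤ N := by exact_mod_cast i.isLt
      have h2 : (0 : ℝ) < N := by exact_mod_cast (by omega : 0 < N)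
      have h3 : 0 ≤ (i.val : ℝ) * ((N : ℝ) - 1 - i.val) :=
        mul_nonneg (Nat.cast_nonneg _) (by linarith)
      simp only [CCG.concaveVector]
      linarith
    · have := CCG.sum_stiffnessEntry_mul_concaveVector_pos hN hσ i.isLt
      rwa [← Fin.sum_univ_eq_sum_range
        (fun j => CCG.stiffnessEntry N σ i j * CCG.concaveVector N j)] at this
  -- The entry (0, 2) is c₀/h = (σ - 1)/(4h) > 0.
  · have hne : (⟨0, by omega⟩ : Fin N) ≠ ⟨2, by omega⟩ := by simp
    have hle := hMM.apply_nonpos hne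
    rw [CCG.stiffness_eq N h hsum] at hle
    have hpos : 0 < 1 / h * ((σ - 1) / 4) := mul_pos (by positivity) (by linarith)
    simp only [Matrix.smul_apply, Matrix.of_apply, CCG.stiffnessEntry, smul_eq_mul] at hle
    norm_num at hle hpos
    linarith
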